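/- Let $W$ be an integrable real random variable on a probability space, with characteristic function $\varphi(t)=\mathbb E[e^{itW}]$. For complex random variables write $\operatorname{Cov}(X,Y)=\mathbb E\big[(X-\mathbb E X)\,\overline{(Y-\mathbb E Y)}\big]$, and let $d_{\mathrm{Kol}}(\mathcal L(W),\mathcal N(0,1))=\sup_{w\in\mathbb R}|\mathbb P(W\le w)-\mathbb P(Z\le w)|$ with $Z$ standard Gaussian. Suppose that there is a complex-valued stochastic process $(H_t)_{t\in\mathbb R}$ on the same probability space such that, for every $t\in\mathbb R$, $H_t$ is integrable and $$\varphi'(t)+t\,\varphi(t)=t^2\,\mathbb E\big[H_t\,e^{itW}\big].$$ Suppose that $t\mapsto t^2\,\mathbb E[H_t]$ and $t\mapsto t^2\operatorname{Cov}(H_t,e^{-itW})$ are continuous on $\mathbb R$, and that for some real numbers $A>0$ and $B\ge 0$ we have $|\mathbb E[H_t]|\le A$ and $|\operatorname{Cov}(H_t,e^{-itW})|\le B$ for all $t\in\mathbb R$. Then $$d_{\mathrm{Kol}}(\mathcal L(W),\mathcal N(0,1))\le\Big(\frac{4}{3\sqrt\pi}+\frac{24\sqrt2}{\pi\sqrt\pi}\Big)A+\frac{2}{\pi}\cdot\frac{B}{A}.$$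 -/

import Mathlib

open MeasureTheory ProbabilityTheory

/-- The Kolmogorov distance `sup_w |E[1_{X ≤ w}] - E[1_{Z ≤ w}]|` of the laws `μ` of `X` and `ν` of
`Z`. For probability measures the supremum is over a bounded set. -/
noncomputable def kolmogorovDist (μ ν : Measure ℝ) : ℝ :=
  ⨆ w : ℝ, |(∫ x, (Set.Iic w).indicator (fun _ => (1 : ℝ)) x ∂μ)
    - ∫ x, (Set.Iic w).indicator (fun _ => (1 : ℝ)) x ∂ν|

/-- The (sesquilinear) covariance `E[(X - E X) * conj (Y - E Y)]` of complex random variables. -/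
noncomputable def complexCov {Ω : Type*} [MeasurableSpace Ω] (X Y : Ω → ℂ) (P : Measure Ω) : ℂ :=
  ∫ ω, (X ω - ∫ ω', X ω' ∂P) * (starRingEnd ℂ) (Y ω - ∫ ω', Y ω' ∂P) ∂P

/-! Splitting `E[H_t e^{itW}] = E[H_t] φ(t) + Cov(H_t, e^{-itW})` turns the hypothesis into a
perturbed Gaussian equation `φ' + tφ = pφ + q` with `|p| ≤ A t²` and `|q| ≤ B t²`. For `0 ≤ t ≤ T =
1/(2A)` one has `A t² ≤ t/2`, so `p` costs the integrating factor `exp(t²/2 - ∫ p)` at most half of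
its exponent, and `norm_sub_exp_neg_sq_div_two_le` bounds `|φ(t) - e^{-t²/2}| / t` by `(A/3) t²
e^{-t²/4} + 2B`.

Esseen's inequality `kolmogorovDist_gaussianReal_le` carries this over to distribution functions:
the distance is at most `2/π` times the integral of that bound over `[0, T]`, plus `24 / (π T
√(2π))`. The integral is at most `(A/3) · 2√π + B/A`, and `T = 1/(2A)` makes the last term a
multiple of `A`.

Esseen's inequality itself has two ingredients: `le_of_forall_convolution_le`, a real-variable
deconvolution argument, and the identity `integral_fejerKernel_mul_measureReal_Iic`, which writes a
Fejér-smoothed distribution function through frequencies in `[0, T]` only. -/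

/-! ### The Fejér kernel: positivity, decay, total mass. -/

/-- The Fejér kernel with bandwidth `T`, the inverse Fourier transform of the triangle function. -/
noncomputable def fejerKernel (T z : ℝ) : ℝ :=
  Real.pi⁻¹ * ∫ t in (0 : ℝ)..T, (1 - t / T) * Real.cos (t * z)

lemma fejerKernel_neg (T z : ℝ) : fejerKernel T (-z) = fejerKernel T z := by
  simp [fejerKernel]

lemma fejerKernel_eq {T z : ℝ} (hT : 0 < T) (hz : z ≠ 0) :
    fejerKernel T z = (1 - Real.cos (T * z)) / (Real.pi * T * z ^ 2) := by
  have key : ∫ t in (0 : ℝ)..T, (1 - t / T) * Real.cos (t * z)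
      = (1 - Real.cos (T * z)) / (T * z ^ 2) := by
    have h : ∀ t ∈ Set.uIcc 0 T, HasDerivAt
        (fun t => (1 - t / T) * (Real.sin (t * z) / z) - Real.cos (t * z) / (T * z ^ 2))
        ((1 - t / T) * Real.cos (t * z)) t := by
      intro t _
      have h1 : HasDerivAt (fun t : ℝ => t * z) z t := by
        simpa using (hasDerivAt_id t).mul_const z
      have h2 : HasDerivAt (fun t : ℝ => 1 - t / T) (-(1 / T)) t := by
        simpa using ((hasDerivAt_id t).div_const T).const_sub 1
      convert! (h2.mul (h1.sin.div_const z)).sub (h1.cos.div_const (T * z ^ 2)) using 1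
      field_simp
      ring
    rw [intervalIntegral.integral_eq_sub_of_hasDerivAt h
      (by apply Continuous.intervalIntegrable; fun_prop)]
    simp [hT.ne']
    field_simp
    ring
  rw [fejerKernel, key]
  field_simp

lemma fejerKernel_nonneg {T : ℝ} (hT : 0 < T) (z : ℝ) : 0 ≤ fejerKernel T z := by
  rcases eq_or_ne z 0 with rfl | hz
  · refine mul_nonneg (by positivity) (intervalIntegral.integral_nonneg hT.le fun t ht => ?_)
    have : t / T ≤ 1 := (div_le_one hT).2 ht.2
    simp [this]
  · rw [fejerKernel_eq hT hz]
    have := Real.cos_le_one (T * z)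
    exact div_nonneg (by linarith) (by positivity)

lemma fejerKernel_le {T z : ℝ} (hT : 0 < T) (hz : z ≠ 0) :
    fejerKernel T z ≤ 2 / (Real.pi * T) * (z ^ 2)⁻¹ := by
  rw [fejerKernel_eq hT hz, ← div_eq_mul_inv, div_div]
  have := Real.neg_one_le_cos (T * z)
  gcongr
  linarith

lemma continuous_fejerKernel (T : ℝ) : Continuous (fejerKernel T) := by
  refine continuous_const.mul ?_
  exact intervalIntegral.continuous_parametric_intervalIntegral_of_continuous'
    (by fun_prop) _ _

lemma fejerKernel_le_const {T : ℝ} (hT : 0 < T) (z : ℝ) : fejerKernel T z ≤ Real.pi⁻¹ * T := by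
  refine mul_le_mul_of_nonneg_left ?_ (by positivity)
  calc ∫ t in (0 : ℝ)..T, (1 - t / T) * Real.cos (t * z) ≤ ∫ t in (0 : ℝ)..T, 1 := by
        refine intervalIntegral.integral_mono_on hT.le
          (by apply Continuous.intervalIntegrable; fun_prop) (by simp) fun t ht => ?_
        have h1 : t / T ≤ 1 := (div_le_one hT).2 ht.2
        have h2 : 0 ≤ t / T := div_nonneg ht.1 hT.le
        nlinarith [Real.cos_le_one (t * z), Real.neg_one_le_cos (t * z)]
    _ = T := by simp

lemma integrable_fejerKernel {T : ℝ} (hT : 0 < T) : Integrable (fejerKernel T) := by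
  refine (integrable_inv_one_add_sq.const_mul
    (Real.pi⁻¹ * T + 2 / (Real.pi * T))).mono' (continuous_fejerKernel T).aestronglyMeasurable
    (.of_forall fun z => ?_)
  rw [Real.norm_of_nonneg (fejerKernel_nonneg hT z), ← div_eq_mul_inv, le_div_iff₀ (by positivity)]
  have h1 := fejerKernel_le_const hT z
  have h2 : fejerKernel T z * z ^ 2 ≤ 2 / (Real.pi * T) := by
    rcases eq_or_ne z 0 with rfl | hz
    · simp; positivity
    · have := fejerKernel_le hT hz
      rwa [← div_eq_mul_inv, le_div_iff₀ (by positivity)] at this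
  linarith

lemma fourier_triangle {T : ℝ} (hT : 0 < T) (w : ℝ) :
    FourierTransform.fourier (fun x : ℝ => ((max 0 (1 - 2 * Real.pi * |x| / T) : ℝ) : ℂ)) w
      = (fejerKernel T w : ℂ) := by
  -- The `2π` in the exponent of the Fourier transform rescales the support `[-T, T]` of the
  -- triangle to `[-a, a]`.
  set a : ℝ := T / (2 * Real.pi) with ha
  have ha0 : 0 < a := by positivity
  have hpi := Real.pi_pos
  set f : ℝ → ℂ := fun x => ((max 0 (1 - 2 * Real.pi * |x| / T) : ℝ) : ℂ) with hf
  have hfc : Continuous f := by fun_prop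
  have hsupp : ∀ x, x ∉ Set.Ioc (-a) a → f x = 0 := by
    intro x hx
    have hx' : a ≤ |x| := by
      by_contra! h
      exact hx ⟨(abs_lt.1 h).1, (abs_lt.1 h).2.le⟩
    simp only [hf, Complex.ofReal_eq_zero]
    apply max_eq_left
    have : 1 ≤ 2 * Real.pi * |x| / T := by
      rw [le_div_iff₀ hT]
      rw [ha, div_le_iff₀ (by positivity)] at hx'
      linarith
    linarith
  rw [Real.fourier_real_eq_integral_exp_smul]
  set g : ℝ → ℂ := fun v => Complex.exp (↑(-2 * Real.pi * v * w) * Complex.I) • f v with hg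
  have hgc : Continuous g := by fun_prop
  have hgn : Continuous fun v => g (-v) := by fun_prop
  have h1 : ∫ v, g v = ∫ v in (-a)..a, g v := by
    rw [intervalIntegral.integral_of_le (by linarith),
      setIntegral_eq_integral_of_forall_compl_eq_zero]
    intro x hx
    simp [hg, hsupp x hx]
  have h2 : ∫ v in (-a)..0, g v = ∫ v in (0 : ℝ)..a, g (-v) := by
    rw [intervalIntegral.integral_comp_neg]; simp
  rw [h1, ← intervalIntegral.integral_add_adjacent_intervals (b := 0)
    (hgc.intervalIntegrable _ _) (hgc.intervalIntegrable _ _), h2,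
    ← intervalIntegral.integral_add (hgn.intervalIntegrable _ _)
    (hgc.intervalIntegrable _ _)]
  have h3 : ∀ v ∈ Set.uIcc 0 a, g (-v) + g v
      = ((2 * ((1 - (2 * Real.pi) * v / T) * Real.cos ((2 * Real.pi) * v * w)) : ℝ) : ℂ) := by
    intro v hv
    rw [Set.uIcc_of_le ha0.le] at hv
    have hfv : f v = ((1 - 2 * Real.pi * v / T : ℝ) : ℂ) := by
      simp only [hf, abs_of_nonneg hv.1]
      congr 1
      apply max_eq_right
      have : 2 * Real.pi * v / T ≤ 1 := by
        rw [div_le_one hT]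
        have := hv.2
        rw [ha, le_div_iff₀ (by positivity)] at this
        linarith
      linarith
    have hfn : f (-v) = f v := by simp [hf]
    simp only [hg, hfn, smul_eq_mul, ← add_mul]
    rw [hfv]
    push_cast
    rw [Complex.cos]
    ring_nf
  rw [intervalIntegral.integral_congr h3, intervalIntegral.integral_ofReal]
  congr 1
  rw [fejerKernel, intervalIntegral.integral_const_mul]
  have := intervalIntegral.integral_comp_mul_left (a := 0) (b := a)
    (fun t => (1 - t / T) * Real.cos (t * w)) (c := 2 * Real.pi) (by positivity)
  rw [this, ha, mul_zero, mul_div_cancel₀ _ (by positivity), smul_eq_mul, mul_inv, ← mul_assoc,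
    ← mul_assoc, mul_inv_cancel₀ two_ne_zero, one_mul]

/-- Fourier inversion at the origin: the triangle function is continuous with integrable transform,
and its value at `0` is `1`. -/
lemma integral_fejerKernel {T : ℝ} (hT : 0 < T) : ∫ z, fejerKernel T z = 1 := by
  have hpi := Real.pi_pos
  set f : ℝ → ℂ := fun x => ((max 0 (1 - 2 * Real.pi * |x| / T) : ℝ) : ℂ) with hf
  have hF : FourierTransform.fourier f = fun w => (fejerKernel T w : ℂ) :=
    funext (fourier_triangle hT)
  have hfc : Continuous f := by fun_prop
  have hfi : Integrable f := by
    apply hfc.integrable_of_hasCompactSupport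
    apply HasCompactSupport.intro (K := Set.Icc (-(T / (2 * Real.pi))) (T / (2 * Real.pi)))
      isCompact_Icc
    intro x hx
    have hx' : T / (2 * Real.pi) ≤ |x| := by
      by_contra! h
      exact hx ⟨(abs_lt.1 h).1.le, (abs_lt.1 h).2.le⟩
    simp only [hf, Complex.ofReal_eq_zero]
    apply max_eq_left
    have : 1 ≤ 2 * Real.pi * |x| / T := by
      rw [le_div_iff₀ hT]
      rw [div_le_iff₀ (by positivity)] at hx'
      linarith
    linarith
  have h := hfi.fourierInv_fourier_eq (by rw [hF]; exact (integrable_fejerKernel hT).ofReal)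
    (v := 0) hfc.continuousAt
  rw [hF, Real.fourierInv_eq] at h
  simp only [inner_zero_right, hf, abs_zero, mul_zero, zero_div, sub_zero,
    AddChar.map_zero_eq_one, one_smul] at h
  rw [integral_complex_ofReal] at h
  simpa using h

lemma setIntegral_Ioi_fejerKernel_le {T h : ℝ} (hT : 0 < T) (hh : 0 < h) :
    ∫ z in Set.Ioi h, fejerKernel T z ≤ 2 / (Real.pi * T) / h := by
  have hpow : IntegrableOn (fun z : ℝ => (z ^ 2)⁻¹) (Set.Ioi h) ∧
      ∫ z in Set.Ioi h, (z ^ 2)⁻¹ = h⁻¹ := by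
    have e : ∀ z ∈ Set.Ioi h, z ^ (-2 : ℝ) = (z ^ 2)⁻¹ := fun z hz => by
      rw [Real.rpow_neg (hh.le.trans (le_of_lt hz))]; norm_cast
    refine ⟨(integrableOn_Ioi_rpow_of_lt (by norm_num) hh).congr_fun e measurableSet_Ioi, ?_⟩
    rw [← setIntegral_congr_fun measurableSet_Ioi e, integral_Ioi_rpow_of_lt (by norm_num) hh]
    norm_num [Real.rpow_neg_one]
  calc ∫ z in Set.Ioi h, fejerKernel T z
      ≤ ∫ z in Set.Ioi h, 2 / (Real.pi * T) * (z ^ 2)⁻¹ :=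
        setIntegral_mono_on (integrable_fejerKernel hT).integrableOn (hpow.1.const_mul _)
          measurableSet_Ioi fun z hz => fejerKernel_le hT (hh.trans hz).ne'
    _ = _ := by rw [integral_const_mul, hpow.2, div_eq_mul_inv _ h]

/-! ### Deconvolution: Esseen's smoothing lemma. -/

/-- One-sided form of Esseen's smoothing lemma: a bounded function that decreases at most at rate
`m` and nearly attains its bound is controlled by its convolution with an even kernel with
quadratically decaying tails. -/
lemma le_of_forall_convolution_le {K D : ℝ → ℝ} {c m η ε M x₀ : ℝ} (hK0 : ∀ x, 0 ≤ K x)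
    (hKi : Integrable K) (hK1 : ∫ x, K x = 1) (hKe : ∀ x, K (-x) = K x)
    (hc : 0 ≤ c) (hKt : ∀ h, 0 < h → ∫ x in Set.Ioi h, K x ≤ c / h)
    (hDm : Measurable D) (hDb : ∀ x, |D x| ≤ η) (hm : 0 < m)
    (hDl : ∀ x s, 0 ≤ s → D x - m * s ≤ D (x + s))
    (hM : ∀ t, |∫ x, K x * D (t - x)| ≤ M) (hε : 0 ≤ ε) (hx₀ : η - ε ≤ D x₀) :
    η ≤ 2 * M + 12 * c * m + 2 * ε := by
  have hη0 : 0 ≤ η := (abs_nonneg _).trans (hDb 0)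
  have hM0 : 0 ≤ M := (abs_nonneg _).trans (hM 0)
  rcases hη0.eq_or_lt with rfl | hη
  · positivity
  -- With this `h`, `D` stays above `η/2 - ε + m x` at `x₀ + h - x` for `|x| ≤ h`. The linear term
  -- vanishes against the even kernel; outside the window only `D ≥ -η` is used. If `q` is the mass
  -- outside, then `q ≤ 2c/h = 4cm/η` and `M ≥ (η/2 - ε)(1 - q) - ηq`, which gives the constants `2`
  -- and `12`.
  set h := η / (2 * m) with hh
  have hhpos : 0 < h := by positivity
  have hmh : m * h = η / 2 := by rw [hh]; field_simp
  have hDi : Integrable fun x => K x * D (x₀ + h - x) :=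
    hKi.mul_bdd (c := η)
      (hDm.comp (measurable_const.sub measurable_id)).aestronglyMeasurable
      (.of_forall fun x => hDb _)
  have htail : ∫ x in Set.Iio (-h), K x = ∫ x in Set.Ioi h, K x := by
    rw [← integral_Iic_eq_integral_Iio, ← integral_comp_neg_Ioi]
    simp [hKe]
  have hdisj : Disjoint (Set.Iio (-h)) (Set.Ioi h) :=
    Set.disjoint_left.2 fun x hx hx' => by
      simp only [Set.mem_Iio, Set.mem_Ioi] at hx hx'; linarith
  set S : Set ℝ := Set.Iio (-h) ∪ Set.Ioi h with hS
  have hSm : MeasurableSet S := measurableSet_Iio.union measurableSet_Ioi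
  have hSc : Sᶜ = Set.Icc (-h) h := by
    ext x; simp [hS]
  have hq : ∫ x in S, K x ≤ 2 * (c / h) := by
    rw [hS, setIntegral_union hdisj measurableSet_Ioi hKi.integrableOn hKi.integrableOn, htail]
    linarith [hKt h hhpos]
  have hsum := integral_add_compl hSm hKi
  have hodd : ∫ x in Set.Icc (-h) h, K x * x = 0 := by
    rw [integral_Icc_eq_integral_Ioc, ← intervalIntegral.integral_of_le (by linarith)]
    have := intervalIntegral.integral_comp_neg (a := -h) (b := h) (fun x => K x * x)
    simp only [hKe, mul_neg, neg_neg, intervalIntegral.integral_neg] at this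
    linarith
  have hKx : IntegrableOn (fun x => K x * x) (Set.Icc (-h) h) := by
    refine hKi.integrableOn.mul_bdd (c := h) (by fun_prop) ?_
    filter_upwards [ae_restrict_mem measurableSet_Icc] with x hx
    exact abs_le.2 hx
  have h1 : -η * ∫ x in S, K x ≤ ∫ x in S, K x * D (x₀ + h - x) := by
    rw [← integral_const_mul]
    refine setIntegral_mono (hKi.integrableOn.const_mul _) hDi.integrableOn fun x => ?_
    have := mul_le_mul_of_nonneg_left (neg_le_of_abs_le (hDb (x₀ + h - x))) (hK0 x)
    linarith
  have h2 : (η / 2 - ε) * ∫ x in Sᶜ, K x ≤ ∫ x in Sᶜ, K x * D (x₀ + h - x) := by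
    have e : (η / 2 - ε) * ∫ x in Sᶜ, K x
        = ∫ x in Sᶜ, ((η / 2 - ε) * K x + m * (K x * x)) := by
      rw [integral_add (hKi.integrableOn.const_mul _) (by rw [hSc]; exact hKx.const_mul _),
        integral_const_mul, integral_const_mul, hSc, hodd]
      ring
    rw [e]
    refine setIntegral_mono_on ((hKi.integrableOn.const_mul _).add
      (by rw [hSc]; exact hKx.const_mul _)) hDi.integrableOn hSm.compl fun x hx => ?_
    rw [hSc] at hx
    have := hDl x₀ (h - x) (by linarith [hx.2])
    rw [← add_sub_assoc] at this
    have := mul_le_mul_of_nonneg_left (show η / 2 - ε + m * x ≤ D (x₀ + h - x) by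
      linarith) (hK0 x)
    linarith
  have h3 := integral_add_compl hSm hDi
  have h4 := (le_abs_self _).trans (hM (x₀ + h))
  have hq0 : 0 ≤ ∫ x in S, K x := setIntegral_nonneg hSm fun x _ => hK0 x
  have hqη : η * ∫ x in S, K x ≤ 4 * c * m := by
    calc η * ∫ x in S, K x ≤ η * (2 * (c / h)) := by gcongr
      _ = 4 * c * m := by rw [hh]; field_simp; ring
  have hp : ∫ x in Sᶜ, K x = 1 - ∫ x in S, K x := by linarith
  rw [hp] at h2
  nlinarith [mul_nonneg hε hq0]

/-- Esseen's smoothing lemma. -/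
lemma iSup_abs_le_of_forall_convolution_le {K D : ℝ → ℝ} {c m η M : ℝ} (hK0 : ∀ x, 0 ≤ K x)
    (hKi : Integrable K) (hK1 : ∫ x, K x = 1) (hKe : ∀ x, K (-x) = K x)
    (hc : 0 ≤ c) (hKt : ∀ h, 0 < h → ∫ x in Set.Ioi h, K x ≤ c / h)
    (hDm : Measurable D) (hDb : ∀ x, |D x| ≤ η) (hm : 0 < m)
    (hDl : ∀ x s, 0 ≤ s → D x - m * s ≤ D (x + s))
    (hM : ∀ t, |∫ x, K x * D (t - x)| ≤ M) :
    ⨆ x, |D x| ≤ 2 * M + 12 * c * m := by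
  have hbdd : BddAbove (Set.range fun x => |D x|) := ⟨η, by rintro _ ⟨x, rfl⟩; exact hDb x⟩
  have hDb' : ∀ x, |D x| ≤ ⨆ x, |D x| := le_ciSup hbdd
  refine le_of_forall_pos_le_add fun ε hε => ?_
  obtain ⟨x₀, hx₀⟩ := exists_lt_of_lt_ciSup (show (⨆ x, |D x|) - ε / 2 < ⨆ x, |D x| by linarith)
  rcases le_total 0 (D x₀) with h0 | h0
  · rw [abs_of_nonneg h0] at hx₀
    have := le_of_forall_convolution_le hK0 hKi hK1 hKe hc hKt hDm hDb' hm hDl hM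
      (half_pos hε).le hx₀.le
    linarith
  -- A near-extremal negative value becomes positive for `-D(-x)`, which satisfies the same
  -- hypotheses.
  · rw [abs_of_nonpos h0] at hx₀
    have := le_of_forall_convolution_le (D := fun x => -D (-x)) (x₀ := -x₀)
      (M := M) hK0 hKi hK1 hKe hc
      hKt (by fun_prop) (by simpa using fun x => hDb' (-x)) hm (fun x s hs => ?_) (fun t => ?_)
      (half_pos hε).le (by simpa using hx₀.le)
    · linarith
    · have := hDl (-(x + s)) s hs
      rw [neg_add_rev, neg_add_cancel_comm] at this
      rw [neg_add_rev]
      linarith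
    · have := hM (-t)
      rw [← integral_neg_eq_self] at this
      simp only [hKe, sub_neg_eq_add] at this
      simpa only [mul_neg, integral_neg, abs_neg, neg_sub, sub_eq_neg_add, neg_add_rev, neg_neg,
        add_comm] using this

/-! ### Fourier representation of smoothed distribution functions. -/

/-- Fubini and `∫ cos(s x) dx = sin(s z)/s`. Writing this as `z * sinc (s * z)` keeps the integrand
continuous at `s = 0`. -/
lemma intervalIntegral_fejerKernel (T z : ℝ) :
    ∫ x in (0 : ℝ)..z, fejerKernel T x
      = Real.pi⁻¹ * ∫ s in (0 : ℝ)..T, (1 - s / T) * (z * Real.sinc (s * z)) := by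
  simp only [fejerKernel]
  rw [intervalIntegral.integral_const_mul, intervalIntegral_intervalIntegral_swap]
  · congr 1
    refine intervalIntegral.integral_congr fun s _ => ?_
    simp only [intervalIntegral.integral_const_mul]
    congr 1
    rcases eq_or_ne s 0 with rfl | hs
    · simp
    rcases eq_or_ne z 0 with rfl | hz
    · simp
    rw [intervalIntegral.integral_comp_mul_left _ hs, integral_cos,
      Real.sinc_of_ne_zero (mul_ne_zero hs hz)]
    simp
    field_simp
  · refine IntegrableOn.mono_set (t := Set.uIcc 0 z ×ˢ Set.uIcc 0 T) ?_
      (Set.prod_mono Set.uIoc_subset_uIcc Set.uIoc_subset_uIcc)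
    exact ContinuousOn.integrableOn_compact (isCompact_uIcc.prod isCompact_uIcc)
      (by unfold Function.uncurry; fun_prop)

lemma setIntegral_Iic_fejerKernel {T : ℝ} (hT : 0 < T) (z : ℝ) :
    ∫ x in Set.Iic z, fejerKernel T x
      = 1 / 2 + Real.pi⁻¹ * ∫ s in (0 : ℝ)..T, (1 - s / T) * (z * Real.sinc (s * z)) := by
  have hi := integrable_fejerKernel hT
  have h1 := intervalIntegral.integral_Iic_sub_Iic (a := 0) (b := z) hi.integrableOn hi.integrableOn
  have h2 : ∫ x in Set.Iic 0, fejerKernel T x = ∫ x in Set.Ioi 0, fejerKernel T x := by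
    have := integral_comp_neg_Iic 0 (fejerKernel T)
    simpa [fejerKernel_neg] using this
  have h3 := integral_add_compl (measurableSet_Iic (a := (0 : ℝ))) hi
  rw [Set.compl_Iic, integral_fejerKernel hT] at h3
  rw [← intervalIntegral_fejerKernel]
  linarith

lemma abs_mul_sinc_le (z s : ℝ) : |z * Real.sinc (s * z)| ≤ |z| := by
  rw [abs_mul]
  exact mul_le_of_le_one_right (abs_nonneg _) (Real.abs_sinc_le_one _)

section Smoothing

variable (μ ν : Measure ℝ) [IsProbabilityMeasure μ] [IsProbabilityMeasure ν]

lemma integral_mul_measureReal_Iic {K : ℝ → ℝ} (hK : Integrable K) (t : ℝ) :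
    ∫ x, K x * μ.real (Set.Iic (t - x)) = ∫ y, (∫ x in Set.Iic (t - y), K x) ∂μ := by
  have e1 : ∀ x, K x * μ.real (Set.Iic (t - x))
      = ∫ y, K x * (Set.Iic (t - x)).indicator 1 y ∂μ := fun x => by
    rw [integral_const_mul, integral_indicator_one measurableSet_Iic]
  have e2 : ∀ y, ∫ x in Set.Iic (t - y), K x
      = ∫ x, K x * (Set.Iic (t - x)).indicator 1 y := fun y => by
    rw [← integral_indicator measurableSet_Iic]
    congr 1 with x
    simp only [Set.indicator, Set.mem_Iic, Pi.one_apply, mul_ite, mul_one, mul_zero,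
      le_sub_comm (a := x)]
  simp only [e1, e2]
  refine integral_integral_swap (f := fun x y => K x * (Set.Iic (t - x)).indicator 1 y)
    ((hK.comp_fst μ).mul_bdd (g := fun p : ℝ × ℝ => (Set.Iic (t - p.1)).indicator 1 p.2) (c := 1)
      ?_ (.of_forall fun p => ?_))
  · have : MeasurableSet {p : ℝ × ℝ | p.2 ≤ t - p.1} :=
      measurableSet_le measurable_snd (by fun_prop)
    exact (measurable_one.indicator this).aestronglyMeasurable
  · simp only [Set.indicator]
    split_ifs <;> simp

/-- The Fourier representation of the Fejér smoothing of a distribution function. -/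
lemma integral_fejerKernel_mul_measureReal_Iic {T : ℝ} (hT : 0 < T) (hμ : Integrable id μ)
    (t : ℝ) :
    ∫ x, fejerKernel T x * μ.real (Set.Iic (t - x)) = 1 / 2 + Real.pi⁻¹ *
      ∫ s in (0 : ℝ)..T, (1 - s / T) * ∫ y, (t - y) * Real.sinc (s * (t - y)) ∂μ := by
  have hty : Integrable (fun y => t - y) μ := (integrable_const t).sub hμ
  have hint : Integrable (Function.uncurry fun s y =>
      (1 - s / T) * ((t - y) * Real.sinc (s * (t - y))))
      ((volume.restrict (Set.uIoc 0 T)).prod μ) := by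
    have hlin : Integrable (fun s => 1 - s / T) (volume.restrict (Set.uIoc 0 T)) :=
      (by fun_prop : Continuous fun s : ℝ => 1 - s / T).integrableOn_uIoc
    refine ((hlin.mul_prod hty).mul_bdd (g := fun p : ℝ × ℝ => Real.sinc (p.1 * (t - p.2)))
      (c := 1) (by fun_prop) (.of_forall fun p => Real.abs_sinc_le_one _)).congr
      (.of_forall fun p => ?_)
    simp [Function.uncurry, mul_assoc]
  rw [integral_mul_measureReal_Iic μ (integrable_fejerKernel hT)]
  simp only [setIntegral_Iic_fejerKernel hT, ← integral_const_mul]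
  rw [intervalIntegral_integral_swap hint, integral_add (by simp), integral_const_mul]
  · simp
  · simp only [intervalIntegral.integral_of_le hT.le, Set.uIoc_of_le hT.le] at hint ⊢
    exact hint.integral_prod_right.const_mul _

/-- The integrand is `s⁻¹ Im e^{is(t-y)}`, so its mean is `s⁻¹ Im(e^{ist} φ(-s))`; conjugation
symmetry returns from `-s` to `s`. -/
lemma abs_integral_sinc_sub_le {s : ℝ} (hs : 0 < s) (t : ℝ) :
    |∫ y, (t - y) * Real.sinc (s * (t - y)) ∂μ - ∫ y, (t - y) * Real.sinc (s * (t - y)) ∂ν|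
      ≤ s⁻¹ * ‖charFun μ s - charFun ν s‖ := by
  have key : ∀ (ρ : Measure ℝ) [IsProbabilityMeasure ρ],
      ∫ y, (t - y) * Real.sinc (s * (t - y)) ∂ρ
        = s⁻¹ * (Complex.exp (s * t * Complex.I) * charFun ρ (-s)).im := by
    intro ρ _
    have e : ∀ y, (t - y) * Real.sinc (s * (t - y))
        = s⁻¹ * (Complex.exp (s * t * Complex.I) * Complex.exp ((-s : ℝ) * y * Complex.I)).im := by
      intro y
      rw [← Complex.exp_add, ← add_mul, show (s * t + (-s : ℝ) * y : ℂ) = ((s * (t - y) : ℝ) : ℂ) by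
        push_cast; ring, Complex.exp_ofReal_mul_I_im]
      rcases eq_or_ne (t - y) 0 with h | h
      · simp [h]
      · rw [Real.sinc_of_ne_zero (mul_ne_zero hs.ne' h)]
        field_simp
    simp only [e]
    rw [integral_const_mul, charFun_apply_real, ← integral_const_mul (Complex.exp _)]
    congr 1
    refine integral_im (𝕜 := ℂ) (μ := ρ) (f := fun y : ℝ =>
      Complex.exp (s * t * Complex.I) * Complex.exp ((-s : ℝ) * y * Complex.I)) ?_
    refine Integrable.of_bound (C := 1) (by fun_prop) (.of_forall fun y => ?_)
    rw [norm_mul]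
    norm_cast
    simp [Complex.norm_exp]
  rw [key μ, key ν, ← mul_sub, abs_mul, abs_of_pos (inv_pos.2 hs), ← Complex.sub_im, ← mul_sub]
  gcongr
  refine (Complex.abs_im_le_norm _).trans ?_
  rw [norm_mul, charFun_neg, charFun_neg, ← map_sub, RCLike.norm_conj]
  norm_cast
  simp [Complex.norm_exp]

lemma abs_integral_fejerKernel_mul_sub_le {T : ℝ} (hT : 0 < T) (hμ : Integrable id μ)
    (hν : Integrable id ν) {b : ℝ → ℝ} (hb : Continuous b)
    (h : ∀ s ∈ Set.Ioc 0 T, ‖charFun μ s - charFun ν s‖ ≤ s * b s) (t : ℝ) :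
    |∫ x, fejerKernel T x * (μ.real (Set.Iic (t - x)) - ν.real (Set.Iic (t - x)))|
      ≤ Real.pi⁻¹ * ∫ s in (0 : ℝ)..T, b s := by
  have hK : ∀ (ρ : Measure ℝ) [IsProbabilityMeasure ρ],
      Integrable fun x => fejerKernel T x * ρ.real (Set.Iic (t - x)) := by
    intro ρ _
    have hm : Monotone fun x => ρ.real (Set.Iic x) := fun x y hxy =>
      measureReal_mono (Set.Iic_subset_Iic.2 hxy)
    refine (integrable_fejerKernel hT).mul_bdd (c := 1)
      (hm.measurable.comp (measurable_const.sub measurable_id)).aestronglyMeasurable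
      (.of_forall fun x => ?_)
    rw [Real.norm_of_nonneg measureReal_nonneg]
    exact measureReal_le_one
  have hJ : ∀ (ρ : Measure ℝ) [IsProbabilityMeasure ρ], Integrable id ρ → IntervalIntegrable
      (fun s => (1 - s / T) * ∫ y, (t - y) * Real.sinc (s * (t - y)) ∂ρ) volume 0 T := by
    intro ρ _ hρ
    refine Continuous.intervalIntegrable ?_ _ _
    refine (by fun_prop : Continuous fun s : ℝ => 1 - s / T).mul ?_
    refine continuous_of_dominated (bound := fun y => |t - y|) (fun s => ?_)
      (fun s => .of_forall fun y => abs_mul_sinc_le _ _) ((integrable_const t).sub hρ).norm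
      (.of_forall fun y => ?_)
    · fun_prop
    · fun_prop
  simp only [mul_sub]
  rw [integral_sub (hK μ) (hK ν), integral_fejerKernel_mul_measureReal_Iic μ hT hμ,
    integral_fejerKernel_mul_measureReal_Iic ν hT hν, add_sub_add_left_eq_sub, ← mul_sub,
    ← intervalIntegral.integral_sub (hJ μ hμ) (hJ ν hν), abs_mul,
    abs_of_pos (inv_pos.2 Real.pi_pos)]
  gcongr
  rw [← Real.norm_eq_abs]
  refine intervalIntegral.norm_integral_le_of_norm_le hT.le
    (.of_forall fun s hs => ?_) (hb.intervalIntegrable _ _)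
  rw [← mul_sub, norm_mul]
  have h1 := (abs_integral_sinc_sub_le μ ν hs.1 t).trans
    (mul_le_mul_of_nonneg_left (h s hs) (inv_pos.2 hs.1).le)
  rw [inv_mul_cancel_left₀ hs.1.ne'] at h1
  refine (mul_le_of_le_one_left (norm_nonneg _) ?_).trans h1
  have h2 : s / T ≤ 1 := (div_le_one hT).2 hs.2
  have h3 : 0 ≤ s / T := div_nonneg hs.1.le hT.le
  exact abs_le.2 ⟨by linarith, by linarith⟩

end Smoothing

/-! ### The perturbed Gaussian differential equation. -/

/-- Integrating-factor estimate: a solution of `φ' + t φ = p φ + q` stays close to the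
Gaussian `exp (-t² / 2)`. -/
lemma norm_sub_exp_neg_sq_div_two_le {φ p q : ℝ → ℂ} {A B T : ℝ} (hA : 0 < A)
    (hAT : A * T ≤ 1 / 2) (hB : 0 ≤ B) (hφ : Differentiable ℝ φ) (hφ0 : φ 0 = 1)
    (hp : Continuous p) (hODE : ∀ t : ℝ, deriv φ t + t * φ t = p t * φ t + q t)
    (hpA : ∀ t, ‖p t‖ ≤ A * t ^ 2) (hqB : ∀ t, ‖q t‖ ≤ B * t ^ 2) {t : ℝ} (ht : t ∈ Set.Ioc 0 T) :
    ‖φ t - Complex.exp (-t ^ 2 / 2)‖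
      ≤ t * (A / 3 * (t ^ 2 * Real.exp (-(1 / 4) * t ^ 2)) + 2 * B) := by
  obtain ⟨ht0, htT⟩ := ht
  -- the integrating factor, normalised to be `1` at `t`
  set k : ℝ → ℂ := fun s => Complex.exp ((s ^ 2 - t ^ 2) / 2 - ∫ r in t..s, p r) with hk
  have hkd : ∀ s : ℝ, HasDerivAt k (k s * (s - p s)) s := by
    intro s
    have h1 : HasDerivAt (fun s : ℝ => ∫ r in t..s, p r) (p s) s :=
      intervalIntegral.integral_hasDerivAt_right (hp.intervalIntegrable _ _)
        (hp.stronglyMeasurableAtFilter _ _) hp.continuousAt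
    have h2 : HasDerivAt (fun s : ℝ => ((s : ℂ) ^ 2 - t ^ 2) / 2) (s : ℂ) s := by
      have := (((hasDerivAt_id s).ofReal_comp.pow 2).sub_const ((t : ℂ) ^ 2)).div_const 2
      simpa using this
    exact (h2.sub h1).cexp
  have hψd : ∀ s : ℝ, HasDerivAt (fun s : ℝ => Complex.exp (-(s : ℂ) ^ 2 / 2))
      (-s * Complex.exp (-(s : ℂ) ^ 2 / 2)) s := by
    intro s
    have h2 : HasDerivAt (fun s : ℝ => -(s : ℂ) ^ 2 / 2) (-s : ℂ) s := by
      have := (((hasDerivAt_id s).ofReal_comp.pow 2).neg).div_const 2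
      simpa [neg_div] using this
    convert! h2.cexp using 1
    ring
  have hgd : ∀ s : ℝ, HasDerivAt (fun s : ℝ => k s * (φ s - Complex.exp (-(s : ℂ) ^ 2 / 2)))
      (k s * (p s * Complex.exp (-(s : ℂ) ^ 2 / 2) + q s)) s := by
    intro s
    convert! (hkd s).mul ((hφ s).hasDerivAt.sub (hψd s)) using 1
    have := hODE s
    simp only [Pi.sub_apply]
    linear_combination (-k s) * this
  have hkn : ∀ s ∈ Set.Icc 0 t, ‖k s‖ ≤ Real.exp ((s ^ 2 - t ^ 2) / 4) := by
    intro s ⟨hs0, hst⟩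
    rw [hk, Complex.norm_exp, Real.exp_le_exp]
    have h1 : ‖∫ r in t..s, p r‖ ≤ (t ^ 2 - s ^ 2) / 4 := by
      rw [intervalIntegral.integral_symm, norm_neg]
      calc ‖∫ r in s..t, p r‖ ≤ ∫ r in s..t, r / 2 := by
            refine intervalIntegral.norm_integral_le_of_norm_le hst (.of_forall fun r hr => ?_)
              (by apply Continuous.intervalIntegrable; fun_prop)
            refine (hpA r).trans ?_
            have hr0 : 0 ≤ r := hs0.trans hr.1.le
            have : A * r ≤ 1 / 2 :=
              (mul_le_mul_of_nonneg_left (hr.2.trans htT) hA.le).trans hAT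
            nlinarith
        _ = (t ^ 2 - s ^ 2) / 4 := by
            rw [intervalIntegral.integral_div, integral_id]; ring
    have h2 := (abs_le.1 (Complex.abs_re_le_norm (∫ r in t..s, p r))).1
    have h3 : (((s : ℂ) ^ 2 - t ^ 2) / 2).re = (s ^ 2 - t ^ 2) / 2 := by norm_cast
    rw [Complex.sub_re, h3]
    linarith
  -- An explicit majorant for the norm of `k (φ - ψ)`, `ψ` the Gaussian. Weakening `|ψ(s)|` to
  -- `e^{-s²/4}` makes its product with the bound on `k` constant in `s`, and weakening `B s²` to `B
  -- t s` gives the `q` term an elementary primitive.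
  have hbd : ∀ s : ℝ, HasDerivAt (fun s => A * Real.exp (-(1 / 4) * t ^ 2) * (s ^ 3 / 3)
      + 2 * B * t * Real.exp ((s ^ 2 - t ^ 2) / 4))
      (A * Real.exp (-(1 / 4) * t ^ 2) * s ^ 2
        + B * t * s * Real.exp ((s ^ 2 - t ^ 2) / 4)) s := by
    intro s
    have h1 : HasDerivAt (fun s : ℝ => (s ^ 2 - t ^ 2) / 4) (s / 2) s := by
      convert! (((hasDerivAt_id s).pow 2).sub_const (t ^ 2)).div_const 4 using 1
      simp; ring
    convert! ((((hasDerivAt_id s).pow 3).div_const 3).const_mul _).add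
      ((h1.exp).const_mul (2 * B * t)) using 1
    simp; ring
  have main := image_norm_le_of_norm_deriv_right_le_deriv_boundary (a := 0) (b := t)
    (fun s _ => (hgd s).continuousAt.continuousWithinAt) (fun s _ => (hgd s).hasDerivWithinAt)
    (by simp [hφ0]; positivity) hbd (fun s hs => ?_) (Set.right_mem_Icc.2 ht0.le)
  · have hkt : k t = 1 := by simp [hk]
    simp only [hkt, one_mul, sub_self, zero_div, Real.exp_zero] at main
    refine main.trans (le_of_eq ?_)
    ring
  · have hs' : s ∈ Set.Icc 0 t := ⟨hs.1, hs.2.le⟩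
    have e1 : ‖Complex.exp (-(s : ℂ) ^ 2 / 2)‖ ≤ Real.exp (-s ^ 2 / 4) := by
      have : (-(s : ℂ) ^ 2 / 2).re = -s ^ 2 / 2 := by norm_cast
      rw [Complex.norm_exp, Real.exp_le_exp, this]
      nlinarith [sq_nonneg s]
    calc ‖k s * (p s * Complex.exp (-(s : ℂ) ^ 2 / 2) + q s)‖
        ≤ Real.exp ((s ^ 2 - t ^ 2) / 4) * (A * s ^ 2 * Real.exp (-s ^ 2 / 4) + B * s ^ 2) := by
          rw [norm_mul]
          refine mul_le_mul (hkn s hs') ((norm_add_le _ _).trans ?_) (norm_nonneg _)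
            (Real.exp_nonneg _)
          rw [norm_mul]
          exact add_le_add (mul_le_mul (hpA s) e1 (norm_nonneg _) (by positivity)) (hqB s)
      _ = A * (Real.exp ((s ^ 2 - t ^ 2) / 4) * Real.exp (-s ^ 2 / 4)) * s ^ 2
          + B * (s * s) * Real.exp ((s ^ 2 - t ^ 2) / 4) := by ring
      _ ≤ _ := by
          rw [← Real.exp_add, show (s ^ 2 - t ^ 2) / 4 + -s ^ 2 / 4 = -(1 / 4) * t ^ 2 by ring,
            mul_assoc B t s]
          gcongr
          · exact hs.1
          · exact hs.2.le

/-! ### Gaussian estimates and Esseen's inequality. -/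

lemma integral_sq_mul_exp_neg_le {T : ℝ} (hT : 0 ≤ T) :
    ∫ s in (0 : ℝ)..T, s ^ 2 * Real.exp (-(1 / 4) * s ^ 2) ≤ 2 * √Real.pi := by
  have hc : Set.EqOn (fun s : ℝ => s ^ (2 : ℝ) * Real.exp (-(1 / 4) * s ^ (2 : ℝ)))
      (fun s => s ^ 2 * Real.exp (-(1 / 4) * s ^ 2)) (Set.Ioi 0) := fun s _ => by norm_cast
  have h1 := integral_rpow_mul_exp_neg_mul_rpow (p := 2) (q := 2) (b := 1 / 4) (by norm_num)
    (by norm_num) (by norm_num)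
  have h2 : IntegrableOn (fun s : ℝ => s ^ 2 * Real.exp (-(1 / 4) * s ^ 2)) (Set.Ioi 0) := by
    refine (integrableOn_rpow_mul_exp_neg_mul_sq (b := 1 / 4) (by norm_num) (s := 2)
      (by norm_num)).congr_fun (fun s _ => by norm_cast) measurableSet_Ioi
  have hG : Real.Gamma ((2 + 1) / 2) = √Real.pi / 2 := by
    rw [show ((2 : ℝ) + 1) / 2 = 1 / 2 + 1 by norm_num, Real.Gamma_add_one (by norm_num),
      Real.Gamma_one_half_eq]
    ring
  have hb : ((1 : ℝ) / 4) ^ (-(2 + 1) / 2 : ℝ) = 8 := by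
    rw [show ((1 : ℝ) / 4) = 2 ^ (-2 : ℝ) by norm_num [Real.rpow_neg],
      ← Real.rpow_mul (by norm_num)]
    norm_num
  rw [setIntegral_congr_fun measurableSet_Ioi hc, hG, hb] at h1
  rw [intervalIntegral.integral_of_le hT]
  refine (setIntegral_mono_set h2 (.of_forall fun s => by positivity)
    Set.Ioc_subset_Ioi_self.eventuallyLE).trans (le_of_eq ?_)
  rw [h1]; ring

lemma integral_indicator_Iic_one (μ : Measure ℝ) (w : ℝ) :
    ∫ x, (Set.Iic w).indicator (fun _ => (1 : ℝ)) x ∂μ = μ.real (Set.Iic w) :=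
  integral_indicator_one measurableSet_Iic

/-- The Gaussian density is at most `1/√(2π)`. This supplies the rate `m` in the smoothing lemma,
since the other distribution function is nondecreasing. -/
lemma gaussianReal_real_Iic_add_sub_le (x : ℝ) {s : ℝ} (hs : 0 ≤ s) :
    (gaussianReal 0 1).real (Set.Iic (x + s)) - (gaussianReal 0 1).real (Set.Iic x)
      ≤ (√(2 * Real.pi))⁻¹ * s := by
  have hpdf : ∀ y, gaussianPDFReal 0 1 y ≤ (√(2 * Real.pi))⁻¹ := fun y => by
    rw [gaussianPDFReal]
    simp only [NNReal.coe_one, mul_one, sub_zero]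
    refine mul_le_of_le_one_right (by positivity) (Real.exp_le_one_iff.2 ?_)
    have := sq_nonneg y
    linarith
  have hmeas : ∀ w, (gaussianReal 0 1).real (Set.Iic w) = ∫ y in Set.Iic w, gaussianPDFReal 0 1 y :=
    fun w => by
      rw [measureReal_def, gaussianReal_apply_eq_integral _ one_ne_zero, ENNReal.toReal_ofReal]
      exact integral_nonneg fun y => gaussianPDFReal_nonneg _ _ _
  have hi := integrable_gaussianPDFReal 0 1
  rw [hmeas, hmeas, intervalIntegral.integral_Iic_sub_Iic hi.integrableOn hi.integrableOn]
  refine (intervalIntegral.integral_mono_on (by linarith) hi.intervalIntegrable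
    intervalIntegrable_const fun y _ => hpdf y).trans (le_of_eq ?_)
  rw [intervalIntegral.integral_const, smul_eq_mul]
  ring

/-- Esseen's inequality for the Kolmogorov distance to the standard Gaussian. -/
lemma kolmogorovDist_gaussianReal_le (μ : Measure ℝ) [IsProbabilityMeasure μ]
    (hμ : Integrable id μ) {T : ℝ} (hT : 0 < T) {b : ℝ → ℝ} (hb : Continuous b)
    (h : ∀ s ∈ Set.Ioc 0 T, ‖charFun μ s - charFun (gaussianReal 0 1) s‖ ≤ s * b s) :
    kolmogorovDist μ (gaussianReal 0 1)
      ≤ 2 * (Real.pi⁻¹ * ∫ s in (0 : ℝ)..T, b s)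
        + 12 * (2 / (Real.pi * T)) * (√(2 * Real.pi))⁻¹ := by
  have hpi := Real.pi_pos
  simp only [kolmogorovDist, integral_indicator_Iic_one]
  have hmono : ∀ (ρ : Measure ℝ) [IsProbabilityMeasure ρ],
      Monotone fun x => ρ.real (Set.Iic x) := fun ρ _ x y hxy =>
    measureReal_mono (Set.Iic_subset_Iic.2 hxy)
  refine iSup_abs_le_of_forall_convolution_le
    (D := fun w => μ.real (Set.Iic w) - (gaussianReal 0 1).real (Set.Iic w)) (η := 1)
    (fejerKernel_nonneg hT) (integrable_fejerKernel hT) (integral_fejerKernel hT)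
    (fejerKernel_neg T) (by positivity) (fun _ hh => setIntegral_Ioi_fejerKernel_le hT hh)
    ((hmono μ).measurable.sub (hmono _).measurable) (fun x => ?_) (by positivity)
    (fun x s hs => ?_)
    (abs_integral_fejerKernel_mul_sub_le μ _ hT hμ (memLp_id_gaussianReal 1 |>.integrable le_rfl)
      hb h)
  · have h1 : μ.real (Set.Iic x) ≤ 1 := measureReal_le_one
    have h2 : (gaussianReal 0 1).real (Set.Iic x) ≤ 1 := measureReal_le_one
    have h3 : 0 ≤ μ.real (Set.Iic x) := measureReal_nonneg
    have h4 : 0 ≤ (gaussianReal 0 1).real (Set.Iic x) := measureReal_nonneg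
    exact abs_le.2 ⟨by linarith, by linarith⟩
  · have h1 := gaussianReal_real_Iic_add_sub_le x hs
    have h2 : μ.real (Set.Iic x) ≤ μ.real (Set.Iic (x + s)) := hmono μ (by linarith)
    linarith

/-! ### From the covariance hypothesis to the final bound. -/

lemma complexCov_exp_neg {Ω : Type*} [MeasurableSpace Ω] (P : Measure Ω) [IsProbabilityMeasure P]
    {W : Ω → ℝ} (hW : AEMeasurable W P) {X : Ω → ℂ} (hX : Integrable X P) (t : ℝ) :
    complexCov X (fun ω => Complex.exp (-(Complex.I * t * W ω))) P
      = ∫ ω, X ω * Complex.exp (Complex.I * t * W ω) ∂P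
        - (∫ ω, X ω ∂P) * ∫ ω, Complex.exp (Complex.I * t * W ω) ∂P := by
  have hn : ∀ ω, ‖Complex.exp (Complex.I * t * W ω)‖ ≤ 1 := fun ω => by
    rw [Complex.norm_exp]; simp
  have hm : AEStronglyMeasurable (fun ω => Complex.exp (Complex.I * t * W ω)) P := by
    fun_prop
  have hconj : ∀ ω, (starRingEnd ℂ) (Complex.exp (-(Complex.I * t * W ω)))
      = Complex.exp (Complex.I * t * W ω) := fun ω => by
    rw [← Complex.exp_conj]; simp
  have hE : Integrable (fun ω => Complex.exp (Complex.I * t * W ω)) P :=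
    .of_bound hm 1 (.of_forall hn)
  have hXE : Integrable (fun ω => X ω * Complex.exp (Complex.I * t * W ω)) P :=
    hX.mul_bdd hm (.of_forall hn)
  simp only [complexCov, map_sub, ← integral_conj, hconj]
  set x := ∫ ω, X ω ∂P
  set e := ∫ ω, Complex.exp (Complex.I * t * W ω) ∂P with he
  have : ∀ ω, (X ω - x) * (Complex.exp (Complex.I * t * W ω) - e)
      = X ω * Complex.exp (Complex.I * t * W ω) - X ω * e
        - (x * Complex.exp (Complex.I * t * W ω) - x * e) := fun ω => by ring
  have h1 : Integrable (fun ω => X ω * Complex.exp (Complex.I * t * W ω) - X ω * e) P :=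
    hXE.sub (hX.mul_const _)
  have h2 : Integrable (fun ω => x * Complex.exp (Complex.I * t * W ω) - x * e) P :=
    (hE.const_mul _).sub (integrable_const _)
  simp only [this]
  rw [integral_sub h1 h2,
    integral_sub hXE (hX.mul_const _), integral_sub (hE.const_mul _) (integrable_const _),
    integral_mul_const, integral_const_mul, ← he]
  simp [x]

theorem mainTheorem3 {Ω : Type*} [MeasurableSpace Ω] (P : Measure Ω) [IsProbabilityMeasure P]
    (W : Ω → ℝ) (hW : Integrable W P)
    (H : ℝ → Ω → ℂ) (hH : ∀ t : ℝ, Integrable (H t) P)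
    (hODE : ∀ t : ℝ,
      deriv (charFun (P.map W)) t + (t : ℂ) * charFun (P.map W) t
        = (t : ℂ) ^ 2 * ∫ ω, H t ω * Complex.exp (Complex.I * t * W ω) ∂P)
    (hcontE : Continuous fun t : ℝ => (t : ℂ) ^ 2 * ∫ ω, H t ω ∂P)
    (hcontCov : Continuous fun t : ℝ =>
      (t : ℂ) ^ 2 * complexCov (H t) (fun ω => Complex.exp (-(Complex.I * t * W ω))) P)
    (A B : ℝ) (hA : 0 < A) (hB : 0 ≤ B)
    (hEA : ∀ t : ℝ, ‖∫ ω, H t ω ∂P‖ ≤ A)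
    (hCovB : ∀ t : ℝ, ‖complexCov (H t) (fun ω => Complex.exp (-(Complex.I * t * W ω))) P‖ ≤ B) :
    kolmogorovDist (P.map W) (gaussianReal 0 1)
      ≤ (4 / (3 * √Real.pi) + 24 * √2 / (Real.pi * √Real.pi)) * A + 2 / Real.pi * (B / A) := by
  have hpi := Real.pi_pos
  have hWm := hW.aemeasurable
  have : IsProbabilityMeasure (P.map W) := Measure.isProbabilityMeasure_map hWm
  have hμ : Integrable id (P.map W) :=
    (integrable_map_measure aestronglyMeasurable_id hWm).2 hW
  have hφd : Differentiable ℝ (charFun (P.map W)) :=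
    (contDiff_charFun (n := 1) (by exact_mod_cast memLp_one_iff_integrable.2 hμ)).differentiable
      (by norm_num)
  have hφ : ∀ t, charFun (P.map W) t = ∫ ω, Complex.exp (Complex.I * t * W ω) ∂P := fun t => by
    rw [charFun_apply_real, integral_map hWm (by fun_prop)]
    congr 1 with ω
    ring_nf
  -- The cutoff `1/(2A)` is the largest `T` allowed by `A * T ≤ 1/2`.
  have hbound : ∀ s ∈ Set.Ioc 0 (1 / (2 * A)),
      ‖charFun (P.map W) s - charFun (gaussianReal 0 1) s‖
        ≤ s * (A / 3 * (s ^ 2 * Real.exp (-(1 / 4) * s ^ 2)) + 2 * B) := by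
    intro s hs
    have hg : charFun (gaussianReal 0 1) s = Complex.exp (-s ^ 2 / 2) := by
      rw [charFun_gaussianReal]
      congr 1
      simp
      ring
    rw [hg]
    refine norm_sub_exp_neg_sq_div_two_le hA (by field_simp; rfl) hB hφd (by simp) hcontE
      (q := fun t : ℝ => (t : ℂ) ^ 2 *
        complexCov (H t) (fun ω => Complex.exp (-(Complex.I * t * W ω))) P)
      (fun t => ?_) (fun t => ?_) (fun t => ?_) hs
    · rw [hODE, complexCov_exp_neg P hWm (hH t), ← hφ]
      ring
    · rw [norm_mul, mul_comm, norm_pow, Complex.norm_real, Real.norm_eq_abs, sq_abs]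
      exact mul_le_mul_of_nonneg_right (hEA t) (sq_nonneg t)
    · rw [norm_mul, mul_comm, norm_pow, Complex.norm_real, Real.norm_eq_abs, sq_abs]
      exact mul_le_mul_of_nonneg_right (hCovB t) (sq_nonneg t)
  refine (kolmogorovDist_gaussianReal_le (P.map W) hμ (by positivity) (by fun_prop)
    hbound).trans ?_
  have hint : ∫ s in (0 : ℝ)..1 / (2 * A),
      (A / 3 * (s ^ 2 * Real.exp (-(1 / 4) * s ^ 2)) + 2 * B)
      ≤ A / 3 * (2 * √Real.pi) + B / A := by
    rw [intervalIntegral.integral_add (by apply Continuous.intervalIntegrable; fun_prop) (by simp),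
      intervalIntegral.integral_const_mul, intervalIntegral.integral_const, smul_eq_mul]
    refine add_le_add (mul_le_mul_of_nonneg_left (integral_sq_mul_exp_neg_le (by positivity))
      (by positivity)) (le_of_eq ?_)
    field_simp
    ring
  have hsq : √Real.pi * √Real.pi = Real.pi := Real.mul_self_sqrt hpi.le
  have h2 : √2 * √2 = (2 : ℝ) := Real.mul_self_sqrt (by norm_num)
  have hsp : 0 < √Real.pi := by positivity
  have e1 : 2 * (Real.pi⁻¹ * (A / 3 * (2 * √Real.pi) + B / A))
      = 4 / (3 * √Real.pi) * A + 2 / Real.pi * (B / A) := by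
    have : Real.pi⁻¹ * √Real.pi = 1 / √Real.pi := by
      field_simp; linarith
    linear_combination (4 * A / 3) * this
  have e2 : 12 * (2 / (Real.pi * (1 / (2 * A)))) * (√(2 * Real.pi))⁻¹
      = 24 * √2 / (Real.pi * √Real.pi) * A := by
    rw [Real.sqrt_mul (by norm_num)]
    field_simp
    linarith
  rw [e2, add_mul]
  have := mul_le_mul_of_nonneg_left (mul_le_mul_of_nonneg_left hint (inv_pos.2 hpi).le)
    (zero_le_two (α := ℝ))
  linarith
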